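/- Let $d\ge 0$ be an integer, let $G$ be a Borel measure on $(0,+\infty)$ whose tail function $\bar G(u)=G((u,+\infty))$ is finite for every $u>0$, and let $\Phi$ be a Poisson point process on $\mathbb{R}^d\times(0,+\infty)$ with intensity $dx\,G(dm)$, realised as a random locally finite subset of $\mathbb{R}^d\times(0,+\infty)$ on a probability space. For a measurable function $h:\mathbb{R}^d\to[0,+\infty]$ define the extremal shot noise $$M(y)=\sup\{m\,h(y-x)\;;\;(x,m)\in\Phi\}\in[0,+\infty],\qquad y\in\mathbb{R}^d,$$ and put $$\alpha(h,G)=\inf\Big\{u\in(0,+\infty)\;;\;\int_{\mathbb{R}^d}\bar G\big(u/h(x)\big)\,dx<+\infty\Big\},$$ with $\inf\emptyset=+\infty$, $\bar G(u/h(x))=0$ if $h(x)=0$, and $\bar G(u/h(x))=G((0,+\infty))$ if $h(x)=+\infty$. With the Euclidean norm $|\cdot|$, let $$h^+(x)=\sup_{|z|\le 1}h(x+z),\qquad h^-_\varepsilon(x)=\inf_{|z|\le\varepsilon}h(x+z)\quad(\varepsilon>0),$$ $$\alpha^+(h,G)=\alpha(h^+,G),\qquad \alpha^-(h,G)=\lim_{\varepsilon\downarrow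 0}\alpha(h^-_\varepsilon,G).$$ A function $f:\mathbb{R}^d\to[0,+\infty]$ is called universally separable if for every countable dense subset $D$ of $\mathbb{R}^d$ and every $t\in\mathbb{R}^d$ there is a sequence $(t_n)$ of points of $D$ with $t_n\to t$ and $f(t_n)\to f(t)$; it is called USUSC if it is universally separable and upper semicontinuous. If $h$ is USUSC and $\alpha^-(h,G)=\alpha^+(h,G)$, then almost surely the function $y\mapsto M(y)$ is USUSC. -/

import Mathlib

open MeasureTheory ProbabilityTheory Filter Topology
open scoped ENNReal NNReal

noncomputable section

namespace ShotNoise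

/-- The space `ℝ^d` with its Euclidean norm and Lebesgue measure `volume`. -/
abbrev Space (d : ℕ) : Type := EuclideanSpace ℝ (Fin d)

/-- The half-line `(0, +∞)` of weights. -/
abbrev Weight : Type := Set.Ioi (0 : ℝ)

/-- The Poisson law with mean `r ∈ [0, +∞]`, with values in `ℕ ∪ {+∞}`; the law with infinite mean
is the Dirac mass at `+∞`. -/
def poissonLaw (r : ℝ≥0∞) : Measure ℕ∞ :=
  if r = ∞ then Measure.dirac ⊤ else (poissonMeasure r.toNNReal).map (fun n : ℕ => (n : ℕ∞))

/-- The random set `Φ` is a Poisson point process with intensity measure `μ`: it is locally finite,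
the number of points in each Borel set `B` is a random variable with Poisson law of mean `μ B`, and
the numbers of points in finitely many pairwise disjoint Borel sets are independent. -/
structure IsPoissonPointProcess {Ω E : Type*} [MeasurableSpace Ω] [TopologicalSpace E]
    [MeasurableSpace E] (Φ : Ω → Set E) (μ : Measure E) (P : Measure Ω) : Prop where
  locallyFinite : ∀ ω, ∀ K : Set E, IsCompact K → (Φ ω ∩ K).Finite
  measurable_count : ∀ B : Set E, MeasurableSet B → Measurable fun ω => (Φ ω ∩ B).encard
  map_count : ∀ B : Set E, MeasurableSet B →
    P.map (fun ω => (Φ ω ∩ B).encard) = poissonLaw (μ B)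
  indep_count : ∀ (n : ℕ) (B : Fin n → Set E), (∀ i, MeasurableSet (B i)) →
    Pairwise (fun i j => Disjoint (B i) (B j)) →
    iIndepFun (fun i ω => (Φ ω ∩ B i).encard) P

/-- The extremal shot noise `M(y) = sup {m h(y - x) ; (x, m) ∈ S}` of the point set `S`
(the supremum over the empty set being `0`). -/
def extremalShotNoise {d : ℕ} (h : Space d → ℝ≥0∞) (S : Set (Space d × Weight)) (y : Space d) :
    ℝ≥0∞ :=
  ⨆ φ ∈ S, ENNReal.ofReal (φ.2 : ℝ) * h (y - φ.1)

/-- The tail function `u ↦ G((u, +∞))` for `u ∈ [0, +∞]`; it is `G((0, +∞))` at `u = 0` and `0` at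
`u = +∞`. -/
def tail (G : Measure Weight) (u : ℝ≥0∞) : ℝ≥0∞ :=
  G {m | u < ENNReal.ofReal (m : ℝ)}

/-- `α(h, G) = inf {u > 0 ; ∫ Ḡ(u / h(x)) dx < +∞}`, which is `+∞` if there is no such `u`.
For `0 < u < +∞` the quotient `u / h(x)` is `+∞` if `h(x) = 0`, and `0` if `h(x) = +∞`. -/
def alpha {d : ℕ} (h : Space d → ℝ≥0∞) (G : Measure Weight) : ℝ≥0∞ :=
  sInf {u : ℝ≥0∞ | 0 < u ∧ u < ∞ ∧ ∫⁻ x, tail G (u / h x) < ∞}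

/-- `h⁺(x) = sup {h(x + z) ; |z| ≤ 1}`. -/
def upperHull {d : ℕ} (h : Space d → ℝ≥0∞) (x : Space d) : ℝ≥0∞ :=
  ⨆ (z : Space d) (_ : ‖z‖ ≤ 1), h (x + z)

/-- `h⁻_ε(x) = inf {h(x + z) ; |z| ≤ ε}`. -/
def lowerHull {d : ℕ} (h : Space d → ℝ≥0∞) (ε : ℝ) (x : Space d) : ℝ≥0∞ :=
  ⨅ (z : Space d) (_ : ‖z‖ ≤ ε), h (x + z)

/-- `α⁺(h, G) = α(h⁺, G)`. -/
def alphaPlus {d : ℕ} (h : Space d → ℝ≥0∞) (G : Measure Weight) : ℝ≥0∞ :=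
  alpha (upperHull h) G

/-- `α⁻(h, G)` is the limit of `α(h⁻_ε, G)` as `ε ↓ 0`; it exists by `tendsto_alphaMinus`. -/
def alphaMinus {d : ℕ} (h : Space d → ℝ≥0∞) (G : Measure Weight) : ℝ≥0∞ :=
  limUnder (𝓝[>] (0 : ℝ)) fun ε => alpha (lowerHull h ε) G

theorem tail_antitone (G : Measure Weight) : Antitone (tail G) := fun _ _ huv =>
  measure_mono fun _ hm => lt_of_le_of_lt huv hm

theorem alpha_mono {d : ℕ} (G : Measure Weight) {h k : Space d → ℝ≥0∞} (hk : h ≤ k) :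
    alpha h G ≤ alpha k G :=
  sInf_le_sInf fun _ hu => ⟨hu.1, hu.2.1, lt_of_le_of_lt
    (lintegral_mono fun x => tail_antitone G (ENNReal.div_le_div_left (hk x) _)) hu.2.2⟩

theorem tendsto_alphaMinus {d : ℕ} (h : Space d → ℝ≥0∞) (G : Measure Weight) :
    Tendsto (fun ε => alpha (lowerHull h ε) G) (𝓝[>] (0 : ℝ)) (𝓝 (alphaMinus h G)) := by
  have hanti : Antitone fun ε : ℝ => alpha (lowerHull h ε) G := fun a b hab =>
    alpha_mono G fun x => le_iInf₂ fun z hz => iInf₂_le z (hz.trans hab)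
  exact tendsto_nhds_limUnder ⟨_, hanti.tendsto_nhdsGT 0⟩

/-- `f` is `D`-separable: each `f(t)` is the limit of `f` along a sequence of points of `D`
that converges to `t`. -/
def IsSeparableFor {E : Type*} [TopologicalSpace E] (D : Set E) (f : E → ℝ≥0∞) : Prop :=
  ∀ t : E, ∃ s : ℕ → E, (∀ n, s n ∈ D) ∧ Tendsto s atTop (𝓝 t) ∧
    Tendsto (fun n => f (s n)) atTop (𝓝 (f t))

/-- `f` is universally separable: it is `D`-separable for every countable dense set `D`. -/
def UniversallySeparable {E : Type*} [TopologicalSpace E] (f : E → ℝ≥0∞) : Prop :=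
  ∀ D : Set E, D.Countable → Dense D → IsSeparableFor D f

/-- `f` is universally separable and upper semicontinuous. -/
def USUSC {E : Type*} [TopologicalSpace E] (f : E → ℝ≥0∞) : Prop :=
  UniversallySeparable f ∧ UpperSemicontinuous f

end ShotNoise

end

/-!
A supremum of upper semicontinuous functions is upper semicontinuous, and attained, wherever only
finitely many of them matter locally, that is above every level `c > a` where `a` is a lower bound
of the supremum; where the supremum equals `a`, upper semicontinuity alone makes it converge along
every sequence. For the extremal shot noise finiteness above `α⁺` and the lower bound `α⁻` hold
almost surely. Each `y` lies within `1` of a point `x` of a countable dense set, so a shot exceeding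
`u` at `y` exceeds `u` at `x` once `h` is replaced by `h⁺`, and for `u > α⁺` the mean number of such
shots is finite. Likewise, for `u < α(h⁻_ε)` the mean number of shots exceeding `u` at `x`, with
`h⁻_ε` for `h`, is infinite, so `M ≥ u` on the whole `ε`-ball around `x`. When `α⁻ = α⁺` both serve
the same level `a`.
-/

namespace ShotNoise

open TopologicalSpace (denseSeq denseRange_denseSeq)

section Suprema

variable {ι E α : Type*} [TopologicalSpace E] [CompleteLinearOrder α]

theorem exists_eq_iSup_of_finite_setOf_lt {g : ι → α} {c : α} (hfin : {i | c < g i}.Finite)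
    (hc : c < ⨆ i, g i) : ∃ i, g i = ⨆ i, g i := by
  obtain ⟨i₀, hi₀⟩ := lt_iSup_iff.1 hc
  obtain ⟨i, hi, hmax⟩ := Set.exists_max_image _ g hfin ⟨i₀, hi₀⟩
  refine ⟨i, (le_iSup g i).antisymm (iSup_le fun j => ?_)⟩
  rcases le_or_gt (g j) c with hj | hj
  · exact hj.trans (le_of_lt hi)
  · exact hmax j hj

theorem upperSemicontinuous_iSup_of_locallyFinite [DenselyOrdered α] {f : ι → E → α} {a : α}
    (hf : ∀ i, UpperSemicontinuous (f i)) (ha : ∀ t, a ≤ ⨆ i, f i t)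
    (hfin : ∀ c, a < c → LocallyFinite fun i => {t | c < f i t}) :
    UpperSemicontinuous fun t => ⨆ i, f i t := by
  intro t c hc
  obtain ⟨b, htb, hbc⟩ := exists_between hc
  obtain ⟨U, hU, hUfin⟩ := hfin b ((ha t).trans_lt htb) t
  have hlarge : ∀ᶠ s in 𝓝 t, ∀ i ∈ {i | ({t | b < f i t} ∩ U).Nonempty}, f i s < b :=
    (eventually_all_finite hUfin).2 fun i _ => hf i t b ((le_iSup (f · t) i).trans_lt htb)
  filter_upwards [hlarge, hU] with s hs hsU
  refine (iSup_le fun i => ?_).trans_lt hbc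
  by_contra! hi
  exact (hs i ⟨s, hi, hsU⟩).not_gt hi

theorem upperSemicontinuous_biSup_of_isCompact {Z : Type*} [TopologicalSpace Z] [DenselyOrdered α]
    {K : Set Z} (hK : IsCompact K) {f : E × Z → α} (hf : UpperSemicontinuous f) :
    UpperSemicontinuous fun t => ⨆ z ∈ K, f (t, z) := by
  intro t c hc
  obtain ⟨b, htb, hbc⟩ := exists_between hc
  have hnear : ∀ᶠ s in 𝓝 t, ∀ z ∈ K, f (s, z) < b :=
    hK.eventually_forall_of_forall_eventually fun z hz =>
      hf (t, z) b ((le_iSup₂ (f := fun z (_ : z ∈ K) => f (t, z)) z hz).trans_lt htb)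
  filter_upwards [hnear] with s hs
  exact (iSup₂_le fun z hz => (hs z hz).le).trans_lt hbc

theorem tendsto_of_upperSemicontinuousAt_of_le [TopologicalSpace α] [OrderTopology α] {X : Type*}
    {l : Filter X} {f : E → α} {t : E} (hf : UpperSemicontinuousAt f t) {s : X → E}
    (hs : Tendsto s l (𝓝 t)) {g : X → α} (hg : Tendsto g l (𝓝 (f t))) (hgf : ∀ x, g x ≤ f (s x)) :
    Tendsto (fun x => f (s x)) l (𝓝 (f t)) := by
  refine tendsto_order.2 ⟨fun b hb => ?_, fun b hb => hs.eventually (hf b hb)⟩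
  filter_upwards [hg.eventually_const_lt hb] with x hx using hx.trans_le (hgf x)

end Suprema

section Separability

variable {ι E F : Type*} [TopologicalSpace E] [TopologicalSpace F]

theorem IsSeparableFor.continuous_comp {D : Set E} {f : E → ℝ≥0∞} (hf : IsSeparableFor D f)
    {g : ℝ≥0∞ → ℝ≥0∞} (hg : Continuous g) : IsSeparableFor D (g ∘ f) := fun t =>
  let ⟨s, hsD, hs, hfs⟩ := hf t
  ⟨s, hsD, hs, (hg.tendsto _).comp hfs⟩

theorem IsSeparableFor.comp_homeomorph {e : E ≃ₜ F} {D : Set E} {f : F → ℝ≥0∞}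
    (hf : IsSeparableFor (e '' D) f) : IsSeparableFor D (f ∘ e) := by
  intro t
  obtain ⟨s, hsD, hs, hfs⟩ := hf (e t)
  refine ⟨e.symm ∘ s, fun n => ?_, ?_, by simpa [Function.comp_def] using hfs⟩
  · obtain ⟨x, hx, hxs⟩ := hsD n
    simpa [← hxs] using hx
  · simpa using (e.symm.continuous.tendsto _).comp hs

theorem USUSC.comp_homeomorph {f : F → ℝ≥0∞} (hf : USUSC f) (e : E ≃ₜ F) : USUSC (f ∘ e) :=
  ⟨fun _ hDc hDd => (hf.1 _ (hDc.image e) (e.surjective.denseRange.dense_image e.continuous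
    hDd)).comp_homeomorph, hf.2.comp e.continuous⟩

theorem USUSC.continuous_comp {f : E → ℝ≥0∞} (hf : USUSC f) {g : ℝ≥0∞ → ℝ≥0∞}
    (hg : Continuous g) (hgm : Monotone g) : USUSC (g ∘ f) :=
  ⟨fun D hDc hDd => (hf.1 D hDc hDd).continuous_comp hg, hg.comp_upperSemicontinuous hf.2 hgm⟩

theorem isSeparableFor_iSup [FrechetUrysohnSpace E] {D : Set E} (hD : Dense D)
    {f : ι → E → ℝ≥0∞} {a : ℝ≥0∞} (hf : ∀ i, IsSeparableFor D (f i))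
    (husc : UpperSemicontinuous fun t => ⨆ i, f i t) (ha : ∀ t, a ≤ ⨆ i, f i t)
    (hmax : ∀ t, a < ⨆ i, f i t → ∃ i, f i t = ⨆ i, f i t) :
    IsSeparableFor D fun t => ⨆ i, f i t := by
  intro t
  rcases (ha t).eq_or_lt with hat | hat
  · obtain ⟨s, hsD, hs⟩ := mem_closure_iff_seq_limit.1 (hD t)
    exact ⟨s, hsD, hs, tendsto_of_upperSemicontinuousAt_of_le (husc t) hs
      (hat ▸ tendsto_const_nhds) fun n => ha (s n)⟩
  · obtain ⟨i, hi⟩ := hmax t hat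
    obtain ⟨s, hsD, hs, hfs⟩ := hf i t
    exact ⟨s, hsD, hs, tendsto_of_upperSemicontinuousAt_of_le (husc t) hs
      (hi ▸ hfs) fun n => le_iSup (f · (s n)) i⟩

theorem ususc_iSup_of_locallyFinite [FrechetUrysohnSpace E] {f : ι → E → ℝ≥0∞} {a : ℝ≥0∞}
    (hf : ∀ i, USUSC (f i)) (ha : ∀ t, a ≤ ⨆ i, f i t)
    (hfin : ∀ c, a < c → LocallyFinite fun i => {t | c < f i t}) :
    USUSC fun t => ⨆ i, f i t := by
  have husc := upperSemicontinuous_iSup_of_locallyFinite (fun i => (hf i).2) ha hfin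
  refine ⟨fun D hDc hDd => isSeparableFor_iSup hDd (fun i => (hf i).1 D hDc hDd) husc ha
    fun t ht => ?_, husc⟩
  obtain ⟨c, hac, hct⟩ := exists_between ht
  exact exists_eq_iSup_of_finite_setOf_lt ((hfin c hac).point_finite t) hct

end Separability

section CountableIntersection

variable {Ω α : Type*} {l : Filter Ω} [CountableInterFilter l] [LinearOrder α]
  [TopologicalSpace α] [OrderTopology α] [DenselyOrdered α] [TopologicalSpace.SeparableSpace α]
  {a : α} {p : α → Ω → Prop}

theorem eventually_forall_lt_of_forall_lt_eventually (hp : ∀ ω, Antitone (p · ω))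
    (h : ∀ u, u < a → ∀ᶠ ω in l, p u ω) : ∀ᶠ ω in l, ∀ u, u < a → p u ω := by
  obtain ⟨s, hs, hsd⟩ := TopologicalSpace.exists_countable_dense α
  have hcount : ∀ᶠ ω in l, ∀ u ∈ s ∩ Set.Iio a, p u ω :=
    (eventually_countable_ball (hs.mono Set.inter_subset_left)).2 fun u hu => h u hu.2
  filter_upwards [hcount] with ω hω u hu
  obtain ⟨v, hvs, huv, hva⟩ := hsd.exists_between hu
  exact hp ω huv.le (hω v ⟨hvs, hva⟩)

theorem eventually_forall_gt_of_forall_gt_eventually (hp : ∀ ω, Monotone (p · ω))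
    (h : ∀ u, a < u → ∀ᶠ ω in l, p u ω) : ∀ᶠ ω in l, ∀ u, a < u → p u ω :=
  eventually_forall_lt_of_forall_lt_eventually (α := αᵒᵈ) (fun ω => (hp ω).dual_left) h

end CountableIntersection

section Poisson

variable {Ω E : Type*} [MeasurableSpace Ω] [TopologicalSpace E] [MeasurableSpace E]
  {Φ : Ω → Set E} {μ : Measure E} {P : Measure Ω} {B : Set E}

theorem ae_poissonLaw_ne_top {r : ℝ≥0∞} (hr : r ≠ ∞) : ∀ᵐ n ∂poissonLaw r, n ≠ ⊤ := by
  rw [poissonLaw, if_neg hr]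
  exact (ae_map_iff measurable_from_top.aemeasurable (measurableSet_singleton ⊤).compl).2
    (Eventually.of_forall ENat.natCast_ne_top)

theorem ae_poissonLaw_top : ∀ᵐ n ∂poissonLaw ∞, n = ⊤ := by
  rw [poissonLaw, if_pos rfl, ae_dirac_eq]
  exact Filter.eventually_pure.2 rfl

theorem IsPoissonPointProcess.ae_count_of_ae_poissonLaw (hΦ : IsPoissonPointProcess Φ μ P)
    (hB : MeasurableSet B) {p : ℕ∞ → Prop} (hp : ∀ᵐ n ∂poissonLaw (μ B), p n) :
    ∀ᵐ ω ∂P, p (Φ ω ∩ B).encard :=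
  ae_of_ae_map (hΦ.measurable_count B hB).aemeasurable (hΦ.map_count B hB ▸ hp)

theorem IsPoissonPointProcess.ae_finite (hΦ : IsPoissonPointProcess Φ μ P)
    (hB : MeasurableSet B) (hμ : μ B ≠ ∞) : ∀ᵐ ω ∂P, (Φ ω ∩ B).Finite :=
  (hΦ.ae_count_of_ae_poissonLaw hB (ae_poissonLaw_ne_top hμ)).mono fun _ =>
    Set.encard_ne_top_iff.1

theorem IsPoissonPointProcess.ae_infinite (hΦ : IsPoissonPointProcess Φ μ P)
    (hB : MeasurableSet B) (hμ : μ B = ∞) : ∀ᵐ ω ∂P, (Φ ω ∩ B).Infinite :=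
  (hΦ.ae_count_of_ae_poissonLaw hB (hμ ▸ ae_poissonLaw_top)).mono fun _ =>
    Set.encard_eq_top_iff.1

end Poisson

section Shots

variable {d : ℕ} {h k : Space d → ℝ≥0∞}

/-- The shot `y ↦ m h(y - x)` that the marked point `φ = (x, m)` contributes to the extremal shot
noise. -/
noncomputable def shot (h : Space d → ℝ≥0∞) (φ : Space d × Weight) (y : Space d) : ℝ≥0∞ :=
  ENNReal.ofReal (φ.2 : ℝ) * h (y - φ.1)

theorem extremalShotNoise_eq_iSup_shot (h : Space d → ℝ≥0∞) (S : Set (Space d × Weight)) :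
    extremalShotNoise h S = fun y => ⨆ φ : S, shot h φ y :=
  funext fun _ => iSup_subtype'

theorem shot_le_extremalShotNoise (h : Space d → ℝ≥0∞) {S : Set (Space d × Weight)}
    {φ : Space d × Weight} (hφ : φ ∈ S) (y : Space d) : shot h φ y ≤ extremalShotNoise h S y :=
  le_iSup₂ (f := fun φ (_ : φ ∈ S) => shot h φ y) φ hφ

theorem USUSC.shot (hh : USUSC h) (φ : Space d × Weight) : USUSC (shot h φ) :=
  (hh.comp_homeomorph (Homeomorph.subRight φ.1)).continuous_comp
    (ENNReal.continuous_const_mul ENNReal.ofReal_ne_top) fun _ _ hab => mul_le_mul_right hab _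

theorem lowerHull_le {ε : ℝ} {x y : Space d} (hxy : dist y x ≤ ε) : lowerHull h ε x ≤ h y :=
  calc lowerHull h ε x ≤ h (x + (y - x)) := iInf₂_le (y - x) (by rwa [← dist_eq_norm])
    _ = h y := by rw [add_sub_cancel]

theorem le_upperHull {x y : Space d} (hxy : dist y x ≤ 1) : h y ≤ upperHull h x :=
  calc h y = h (x + (y - x)) := by rw [add_sub_cancel]
    _ ≤ upperHull h x :=
      le_iSup₂ (f := fun (z : Space d) (_ : ‖z‖ ≤ 1) => h (x + z)) (y - x)
        (by rwa [← dist_eq_norm])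

theorem shot_lowerHull_le {ε : ℝ} {x y : Space d} (hxy : dist y x ≤ ε) (φ : Space d × Weight) :
    shot (lowerHull h ε) φ x ≤ shot h φ y :=
  mul_le_mul_right (lowerHull_le (by rwa [dist_sub_right])) _

theorem shot_le_shot_upperHull {x y : Space d} (hxy : dist y x ≤ 1) (φ : Space d × Weight) :
    shot h φ y ≤ shot (upperHull h) φ x :=
  mul_le_mul_right (le_upperHull (by rwa [dist_sub_right])) _

theorem upperSemicontinuous_lowerHull (hh : UpperSemicontinuous h) (ε : ℝ) :
    UpperSemicontinuous (lowerHull h ε) :=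
  upperSemicontinuous_iInf fun _ => upperSemicontinuous_iInf fun _ =>
    hh.comp (continuous_add_const _)

theorem upperSemicontinuous_upperHull (hh : UpperSemicontinuous h) :
    UpperSemicontinuous (upperHull h) := by
  simpa only [mem_closedBall_zero_iff] using! upperSemicontinuous_biSup_of_isCompact
    (isCompact_closedBall (0 : Space d) 1) (hh.comp continuous_add)

/-- The marked points whose shot of shape `k` exceeds the level `u` at `y`. The number of points of
a Poisson point process in such a set is governed by `α(k, G)`. -/
def exceedance (k : Space d → ℝ≥0∞) (u : ℝ≥0∞) (y : Space d) : Set (Space d × Weight) :=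
  {φ | u < shot k φ y}

theorem exceedance_anti (k : Space d → ℝ≥0∞) (y : Space d) : Antitone (exceedance k · y) :=
  fun _ _ huv _ hφ => huv.trans_lt hφ

theorem measurableSet_exceedance (hk : Measurable k) (u : ℝ≥0∞) (y : Space d) :
    MeasurableSet (exceedance k u y) := by
  unfold exceedance shot
  exact measurableSet_lt measurable_const (by fun_prop)

variable {G : Measure Weight} [SFinite G] {u : ℝ≥0∞}

theorem measure_exceedance (hk : Measurable k) (hu₀ : u ≠ 0) (hu : u ≠ ∞) (y : Space d) :
    (volume : Measure (Space d)).prod G (exceedance k u y) = ∫⁻ x, tail G (u / k x) := by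
  rw [Measure.prod_apply (measurableSet_exceedance hk u y),
    ← lintegral_sub_left_eq_self (fun x => tail G (u / k x)) y]
  simp only [tail, ENNReal.div_lt_iff (Or.inr hu₀) (Or.inr hu)]
  rfl

theorem measure_exceedance_eq_top_of_lt_alpha (hk : Measurable k) (hu₀ : u ≠ 0)
    (hu : u < alpha k G) (y : Space d) :
    (volume : Measure (Space d)).prod G (exceedance k u y) = ∞ := by
  rw [measure_exceedance hk hu₀ hu.ne_top]
  by_contra hfin
  exact hu.not_ge (sInf_le ⟨pos_iff_ne_zero.2 hu₀, hu.lt_top, lt_top_iff_ne_top.2 hfin⟩)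

theorem measure_exceedance_lt_top_of_alpha_lt (hk : Measurable k) (hu : alpha k G < u)
    (y : Space d) : (volume : Measure (Space d)).prod G (exceedance k u y) < ∞ := by
  obtain ⟨v, ⟨hv₀, hv, hvfin⟩, hvu⟩ := sInf_lt_iff.1 hu
  rw [← measure_exceedance hk hv₀.ne' hv.ne y] at hvfin
  exact (measure_mono (exceedance_anti k y hvu.le)).trans_lt hvfin

end Shots

section ExtremalShotNoise

variable {Ω : Type*} [MeasurableSpace Ω] {P : Measure Ω} {d : ℕ} {G : Measure Weight}
  [SFinite G] {Φ : Ω → Set (Space d × Weight)} {h : Space d → ℝ≥0∞} {u : ℝ≥0∞}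

theorem ae_le_extremalShotNoise_of_lt_alpha_lowerHull
    (hΦ : IsPoissonPointProcess Φ ((volume : Measure (Space d)).prod G) P)
    (hh : UpperSemicontinuous h) {ε : ℝ} (hε : 0 < ε) (hu : u < alpha (lowerHull h ε) G) :
    ∀ᵐ ω ∂P, ∀ y, u ≤ extremalShotNoise h (Φ ω) y := by
  rcases eq_or_ne u 0 with rfl | hu₀
  · exact Eventually.of_forall fun _ _ => zero_le
  have hmeas := (upperSemicontinuous_lowerHull hh ε).measurable
  have hdense : ∀ᵐ ω ∂P, ∀ n,
      (Φ ω ∩ exceedance (lowerHull h ε) u (denseSeq (Space d) n)).Infinite :=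
    ae_all_iff.2 fun n => hΦ.ae_infinite (measurableSet_exceedance hmeas u _)
      (measure_exceedance_eq_top_of_lt_alpha hmeas hu₀ hu _)
  filter_upwards [hdense] with ω hω y
  obtain ⟨n, hn⟩ := (denseRange_denseSeq (Space d)).exists_dist_lt y hε
  obtain ⟨φ, hφ, hlt⟩ := (hω n).nonempty
  calc u ≤ shot (lowerHull h ε) φ (denseSeq (Space d) n) := le_of_lt hlt
    _ ≤ shot h φ y := shot_lowerHull_le hn.le φ
    _ ≤ extremalShotNoise h (Φ ω) y := shot_le_extremalShotNoise h hφ y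

theorem ae_alphaMinus_le_extremalShotNoise
    (hΦ : IsPoissonPointProcess Φ ((volume : Measure (Space d)).prod G) P)
    (hh : UpperSemicontinuous h) :
    ∀ᵐ ω ∂P, ∀ y, alphaMinus h G ≤ extremalShotNoise h (Φ ω) y := by
  have hlevel : ∀ u, u < alphaMinus h G → ∀ᵐ ω ∂P, ∀ y, u ≤ extremalShotNoise h (Φ ω) y := by
    intro u hu
    obtain ⟨ε, hεu, hε⟩ := (((tendsto_alphaMinus h G).eventually_const_lt hu).and
      self_mem_nhdsWithin).exists
    exact ae_le_extremalShotNoise_of_lt_alpha_lowerHull hΦ hh hε hεu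
  have hlevels := eventually_forall_lt_of_forall_lt_eventually
    (p := fun u ω => ∀ y, u ≤ extremalShotNoise h (Φ ω) y)
    (fun _ _ _ huv hv y => huv.trans (hv y)) hlevel
  filter_upwards [hlevels] with ω hω y
  exact le_of_forall_lt_imp_le_of_dense fun u hu => hω u hu y

theorem ae_locallyFinite_shot_of_alphaPlus_lt
    (hΦ : IsPoissonPointProcess Φ ((volume : Measure (Space d)).prod G) P)
    (hh : UpperSemicontinuous h) (hu : alphaPlus h G < u) :
    ∀ᵐ ω ∂P, LocallyFinite fun φ : Φ ω => {y | u < shot h φ y} := by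
  have hmeas := (upperSemicontinuous_upperHull hh).measurable
  have hdense : ∀ᵐ ω ∂P, ∀ n,
      (Φ ω ∩ exceedance (upperHull h) u (denseSeq (Space d) n)).Finite :=
    ae_all_iff.2 fun n => hΦ.ae_finite (measurableSet_exceedance hmeas u _)
      (measure_exceedance_lt_top_of_alpha_lt hmeas hu _).ne
  filter_upwards [hdense] with ω hω t
  obtain ⟨n, hn⟩ := (denseRange_denseSeq (Space d)).exists_dist_lt t one_pos
  refine ⟨Metric.ball (denseSeq (Space d) n) 1, Metric.isOpen_ball.mem_nhds hn,
    ((hω n).preimage Subtype.val_injective.injOn).subset ?_⟩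
  rintro φ ⟨y, hlt, hy⟩
  exact ⟨φ.2, hlt.trans_le (shot_le_shot_upperHull (Metric.mem_ball.1 hy).le φ)⟩

theorem ae_forall_alphaPlus_lt_locallyFinite_shot
    (hΦ : IsPoissonPointProcess Φ ((volume : Measure (Space d)).prod G) P)
    (hh : UpperSemicontinuous h) :
    ∀ᵐ ω ∂P, ∀ u, alphaPlus h G < u → LocallyFinite fun φ : Φ ω => {y | u < shot h φ y} :=
  eventually_forall_gt_of_forall_gt_eventually
    (fun _ _ _ huv hu => hu.subset fun _ _ => huv.trans_lt)
    fun _ => ae_locallyFinite_shot_of_alphaPlus_lt hΦ hh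

end ExtremalShotNoise

theorem sigmaFinite_of_tail_lt_top {G : Measure Weight}
    (hG : ∀ u : ℝ, 0 < u → tail G (ENNReal.ofReal u) < ∞) : SigmaFinite G := by
  refine ⟨⟨⟨fun n => {m | ENNReal.ofReal (1 / ((n : ℝ) + 1)) < ENNReal.ofReal (m : ℝ)},
    fun _ => trivial, fun n => hG _ Nat.one_div_pos_of_nat, ?_⟩⟩⟩
  refine Set.eq_univ_of_forall fun m => Set.mem_iUnion.2 ?_
  obtain ⟨n, hn⟩ := exists_nat_one_div_lt (Set.mem_Ioi.1 m.2)
  exact ⟨n, (ENNReal.ofReal_lt_ofReal_iff m.2).2 hn⟩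

end ShotNoise

theorem proposition2p7_general {Ω : Type*} [MeasurableSpace Ω] {P : Measure Ω} {d : ℕ}
    {G : Measure ShotNoise.Weight} [SFinite G]
    {Φ : Ω → Set (ShotNoise.Space d × ShotNoise.Weight)}
    (hΦ : ShotNoise.IsPoissonPointProcess Φ
      ((volume : Measure (ShotNoise.Space d)).prod G) P)
    {h : ShotNoise.Space d → ℝ≥0∞} (hh : ShotNoise.USUSC h)
    (hα : ShotNoise.alphaMinus h G = ShotNoise.alphaPlus h G) :
    ∀ᵐ ω ∂P, ShotNoise.USUSC (ShotNoise.extremalShotNoise h (Φ ω)) := by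
  filter_upwards [ShotNoise.ae_alphaMinus_le_extremalShotNoise hΦ hh.2,
    ShotNoise.ae_forall_alphaPlus_lt_locallyFinite_shot hΦ hh.2] with ω hlow hfin
  rw [hα, ShotNoise.extremalShotNoise_eq_iSup_shot] at hlow
  rw [ShotNoise.extremalShotNoise_eq_iSup_shot]
  exact ShotNoise.ususc_iSup_of_locallyFinite (fun φ => hh.shot φ) hlow hfin

theorem proposition2p7 {Ω : Type*} [MeasurableSpace Ω] (P : Measure Ω) [IsProbabilityMeasure P]
    (d : ℕ) (G : Measure ShotNoise.Weight)
    (hG : ∀ u : ℝ, 0 < u → ShotNoise.tail G (ENNReal.ofReal u) < ∞)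
    (Φ : Ω → Set (ShotNoise.Space d × ShotNoise.Weight))
    (hΦ : ShotNoise.IsPoissonPointProcess Φ
      ((volume : Measure (ShotNoise.Space d)).prod G) P)
    (h : ShotNoise.Space d → ℝ≥0∞) (hh : ShotNoise.USUSC h)
    (hα : ShotNoise.alphaMinus h G = ShotNoise.alphaPlus h G) :
    ∀ᵐ ω ∂P, ShotNoise.USUSC (ShotNoise.extremalShotNoise h (Φ ω)) := by
  have := ShotNoise.sigmaFinite_of_tail_lt_top hG
  exact proposition2p7_general hΦ hh hα
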